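/- **Setting.** Let $(\Omega,\mathcal F,\mathbb P)$ be a probability space, $E=\{1,\dots,N\}$, and let $\{(X_n,\tau_n):n\in\mathbb N\}$ be a Markov renewal process with values in $E\times[0,\infty)$, i.e. for all $n\ge 0$, $x,y\in E$ and Borel sets $B$, $$\mathbb P\big(X_{n+1}=y,\ \tau_{n+1}\in B\mid (X_0,\tau_0),\dots,(X_n,\tau_n)\big)=\pi(x,y)\,G_x(B)\qquad\text{on }\{X_n=x\},$$ where $\pi$ is a stochastic matrix on $E$ and the $G_x$ are probability laws; the law of $X_0$ is arbitrary. Assume that 1. $\pi$ is irreducible; 2. either the waiting times are constant given the state ($G_x=\delta_{c_x}$ for every $x$), or every $G_x$ has a finite continuous density $g_x$ on $(0,\infty)$ with $g_x(t)>0$ for a.e. $t>0$; 3. every $G_x$ has a finite mean $\mu_x>0$. Put $T_0=0$, $T_n=\sum_{k=1}^n\tau_k$, $N(t)=\max\{n: T_n\le t\}$, $Z(t)=X_{N(t)}$, and let $\mathcal F_t$ be the $\sigma$-algebra generated by the events $\{T_n\le s\}\cap\{(X_0,\dots,X_n)\in B\}$, $s\le t$, $n\in\mathbb N$, $B\subset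 E^{n+1}$. Let $H$ be a separable complex Hilbert space and, for $j\in E$, let $A_j:D(A_j)\subset H\to H$ be a closed, densely defined operator that generates a strongly continuous, analytic semigroup of contractions $(e^{tA_j})_{t\ge0}$ and has no spectral value on $i\mathbb R$, with the possible exception of $0$. Let $f\in H$. A path $u:[0,\infty)\to H$ *solves* $u'(t)=A(Z(t))u(t)$, $u(0)=f$ (where $A(Z(t))=A_{X_n}$ for $t\in[T_n,T_{n+1})$) if $u(0)=f$, $u$ is càglàd (left-continuous with right limits), and for every $n\ge 0$: $u\in C^1((T_n,T_{n+1});H)$; $u(t)\in D(A_{X_n})$ and $u'(t)=A_{X_n}u(t)$ for all $t\in(T_n,T_{n+1})$; and $u(T_n)$ is attained as initial value of the $n$-th piece, $\lim_{t\downarrow T_n}u(t)=u(T_n)$. A *solution* of the random Cauchy problem is an $(\mathcal F_t)$-adapted $H$-valued process $(u(t))_{t\ge0}$ whose trajectories almost surely solve it in this sense. **Theorem.** Almost surely $0=T_0<T_1<T_2<\cdots$ and $T_n\to\infty$. The random Cauchy problem $$u'(t)=A(Z(t))u(t),\qquad u(0)=f,$$ has a solution, namely $u(t)=S(t)f$ with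 the random propagator $(S(t))_{t\ge0}\subset\mathcal L(H)$ given by the ordered product (later factors on the left) $$S(t)=e^{(t-T_n)A_{X_n}}\,e^{(T_n-T_{n-1})A_{X_{n-1}}}\cdots e^{(T_1-T_0)A_{X_0}},\qquad t\in[T_n,T_{n+1}),\ n\in\mathbb N.$$ It is unique: every $H$-valued process $v$ (adapted or not) whose trajectories almost surely solve the problem satisfies, almost surely, $v(t)=S(t)f$ for all $t\ge0$. In particular, the solution has almost surely continuous sample paths. -/

import Mathlib

open Set Filter Topology MeasureTheory

namespace RandomEvolution

noncomputable section

/-! ### Semigroups and generators -/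

section Semigroups

variable {H : Type*} [NormedAddCommGroup H] [InnerProductSpace ℂ H]

/-- `T` is a strongly continuous one-parameter semigroup of bounded operators
(only the values `T t` with `t ≥ 0` matter). -/
structure IsC0Semigroup (T : ℝ → H →L[ℂ] H) : Prop where
  zero : T 0 = 1
  add : ∀ s t : ℝ, 0 ≤ s → 0 ≤ t → T (s + t) = T s * T t
  continuousOn : ∀ x : H, ContinuousOn (fun t => T t x) (Ici 0)

/-- The open sector of half-angle `δ` around the positive real axis, without its vertex. -/
def sector (δ : ℝ) : Set ℂ := {z | z ≠ 0 ∧ |z.arg| < δ}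

/-- `T` extends to an analytic semigroup on some sector of half-angle `δ ∈ (0, π/2]`. -/
def IsAnalyticSemigroup (T : ℝ → H →L[ℂ] H) : Prop :=
  ∃ δ : ℝ, 0 < δ ∧ δ ≤ Real.pi / 2 ∧ ∃ U : ℂ → H →L[ℂ] H,
    (∀ t : ℝ, 0 < t → U (t : ℂ) = T t) ∧
    (∀ z ∈ sector δ, ∀ w ∈ sector δ, U (z + w) = U z * U w) ∧
    DifferentiableOn ℂ U (sector δ) ∧
    ∀ δ' : ℝ, 0 < δ' → δ' < δ → ∀ x : H,
      Tendsto (fun z => U z x) (𝓝[sector δ'] 0) (𝓝 x)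

/-- `A`, with its domain, is the infinitesimal generator of `T`: the pair `(x, y)` lies in the
graph of `A` iff `(T t x - x) / t → y` as `t ↓ 0`. -/
def IsGeneratorOf (A : H →ₗ.[ℂ] H) (T : ℝ → H →L[ℂ] H) : Prop :=
  ∀ x y : H, (x, y) ∈ A.graph ↔
    Tendsto (fun t : ℝ => t⁻¹ • (T t x - x)) (𝓝[>] 0) (𝓝 y)

/-- `z` belongs to the resolvent set of the unbounded operator `A`: the map
`z - A : D(A) → H` has a bounded two-sided inverse. -/
def InResolventSet (A : H →ₗ.[ℂ] H) (z : ℂ) : Prop :=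
  ∃ R : H →L[ℂ] H,
    (∀ y : H, ∃ h : R y ∈ A.domain, z • R y - A ⟨R y, h⟩ = y) ∧
    ∀ x : A.domain, R (z • (x : H) - A x) = x

/-- `A` is closed and densely defined, it generates the strongly continuous, analytic semigroup
of contractions `T` (that is, `T t = e^{tA}`), and it has no spectral value on the
imaginary axis, except possibly `0`. -/
structure OperatorAssumption (A : H →ₗ.[ℂ] H) (T : ℝ → H →L[ℂ] H) : Prop where
  closed : A.IsClosed
  dense : Dense (A.domain : Set H)
  semigroup : IsC0Semigroup T
  generator : IsGeneratorOf A T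
  analytic : IsAnalyticSemigroup T
  contraction : ∀ t : ℝ, 0 ≤ t → ‖T t‖ ≤ 1
  spectrum : ∀ r : ℝ, r ≠ 0 → InResolventSet A ((r : ℂ) * Complex.I)

end Semigroups

/-! ### The semi-Markov process -/

section SemiMarkov

variable {Ω : Type*} {N : ℕ}

/-- The regeneration times `T_n = τ_1 + ⋯ + τ_n`, `T_0 = 0`. -/
def regTime (τ : ℕ → Ω → ℝ) (n : ℕ) (ω : Ω) : ℝ := ∑ k ∈ Finset.range n, τ (k + 1) ω

/-- The counting process `N(t) = max {n | T_n ≤ t}`. -/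
def count (τ : ℕ → Ω → ℝ) (t : ℝ) (ω : Ω) : ℕ := sSup {n : ℕ | regTime τ n ω ≤ t}

/-- The semi-Markov process `Z(t) = X_{N(t)}`. -/
def semiMarkov (X : ℕ → Ω → Fin N) (τ : ℕ → Ω → ℝ) (t : ℝ) (ω : Ω) : Fin N :=
  X (count τ t ω) ω

/-- The σ-algebra generated by `(X_0, τ_0), …, (X_n, τ_n)`. -/
def history (X : ℕ → Ω → Fin N) (τ : ℕ → Ω → ℝ) (n : ℕ) : MeasurableSpace Ω :=
  ⨆ k ∈ Finset.range (n + 1),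
    MeasurableSpace.comap (fun ω => (X k ω, τ k ω)) inferInstance

/-- The σ-algebra of the events observable up to time `t`, generated by the events
`{T_n ≤ s} ∩ {(X_0, …, X_n) ∈ B}` with `s ≤ t`. -/
def observed (X : ℕ → Ω → Fin N) (τ : ℕ → Ω → ℝ) (t : ℝ) : MeasurableSpace Ω :=
  MeasurableSpace.generateFrom
    {S | ∃ s ≤ t, ∃ (n : ℕ) (B : Set (Fin (n + 1) → Fin N)),
      S = {ω | regTime τ n ω ≤ s ∧ (fun i : Fin (n + 1) => X i ω) ∈ B}}

/-- `{(X_n, τ_n)}` is a Markov renewal process on `{1, …, N} × [0, ∞)` with transition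
probabilities `P(X_{n+1} = y, τ_{n+1} ∈ B | X_n = x) = π(x, y) G_x(B)`, the conditional
probability being the same given the whole history. The initial law is arbitrary. -/
structure IsMarkovRenewal [MeasurableSpace Ω] (P : Measure Ω) (X : ℕ → Ω → Fin N)
    (τ : ℕ → Ω → ℝ) (π : Matrix (Fin N) (Fin N) ℝ) (G : Fin N → Measure ℝ) : Prop where
  measurable_state : ∀ n, Measurable (X n)
  measurable_time : ∀ n, Measurable (τ n)
  time_nonneg : ∀ n ω, 0 ≤ τ n ω
  stochastic : π ∈ Matrix.rowStochastic ℝ (Fin N)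
  law : ∀ x, IsProbabilityMeasure (G x)
  markov : ∀ (n : ℕ) (S : Set Ω), MeasurableSet[history X τ n] S →
    ∀ (x y : Fin N) (B : Set ℝ), MeasurableSet B →
      P (S ∩ {ω | X n ω = x ∧ X (n + 1) ω = y ∧ τ (n + 1) ω ∈ B}) =
        P (S ∩ {ω | X n ω = x}) * (ENNReal.ofReal (π x y) * G x B)

/-- `ν` has a density on `(0, ∞)` that is finite, continuous and almost everywhere positive. -/
def HasPositiveContinuousDensity (ν : Measure ℝ) : Prop :=
  ∃ g : ℝ → ℝ, ContinuousOn g (Ioi 0) ∧ (∀ᵐ t ∂volume.restrict (Ioi 0), 0 < g t) ∧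
    ν = (volume.restrict (Ioi 0)).withDensity (fun t => ENNReal.ofReal (g t))

/-- The standing assumption on the switching mechanism: irreducible embedded chain, waiting
times that are either constant (given the state) or have a positive continuous density, and
finite positive mean waiting times. -/
structure SwitchingAssumption [MeasurableSpace Ω] (P : Measure Ω) (X : ℕ → Ω → Fin N)
    (τ : ℕ → Ω → ℝ) (π : Matrix (Fin N) (Fin N) ℝ) (G : Fin N → Measure ℝ) : Prop where
  renewal : IsMarkovRenewal P X τ π G
  irreducible : π.IsIrreducible
  waiting : (∃ c : Fin N → ℝ, ∀ x, G x = Measure.dirac (c x)) ∨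
    ∀ x, HasPositiveContinuousDensity (G x)
  integrable : ∀ x, Integrable (fun t : ℝ => t) (G x)
  mean_pos : ∀ x, 0 < ∫ t, t ∂(G x)

end SemiMarkov

/-! ### Solutions and the random propagator -/

section Solutions

variable {Ω : Type*} {N : ℕ} {H : Type*} [NormedAddCommGroup H] [InnerProductSpace ℂ H]

/-- Left-continuous with right limits on `[0, ∞)`. -/
def IsCaglad (u : ℝ → H) : Prop :=
  (∀ t : ℝ, 0 < t → Tendsto u (𝓝[<] t) (𝓝 (u t))) ∧
    ∀ t : ℝ, 0 ≤ t → ∃ l : H, Tendsto u (𝓝[>] t) (𝓝 l)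

/-- `u` solves `u'(t) = A(z(t)) u(t)`, `u(0) = f`, piecewise on `[0, ∞)`, where `z` is constant
between the consecutive switching times `s 0 = 0, s 1, s 2, …`: it is càglàd and, on each
interval, it is a classical solution of the Cauchy problem with initial value `u (s n)`, which is
attained as `t ↓ s n`. -/
structure IsSolutionPath (A : Fin N → H →ₗ.[ℂ] H) (s : ℕ → ℝ) (z : ℝ → Fin N) (f : H)
    (u : ℝ → H) : Prop where
  init : u 0 = f
  caglad : IsCaglad u
  start : ∀ n, Tendsto u (𝓝[>] (s n)) (𝓝 (u (s n)))
  contDiffOn : ∀ n, ContDiffOn ℝ 1 u (Ioo (s n) (s (n + 1)))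
  equation : ∀ n, ∀ t ∈ Ioo (s n) (s (n + 1)),
    ∃ h : u t ∈ (A (z t)).domain, HasDerivAt u (A (z t) ⟨u t, h⟩) t

/-- Almost every trajectory of the process `u` solves the random Cauchy problem
`u'(t) = A(Z(t)) u(t)`, `u(0) = f`. -/
def SolvesAlmostSurely [MeasurableSpace Ω] (P : Measure Ω) (X : ℕ → Ω → Fin N) (τ : ℕ → Ω → ℝ)
    (A : Fin N → H →ₗ.[ℂ] H) (f : H) (u : ℝ → Ω → H) : Prop :=
  ∀ᵐ ω ∂P, IsSolutionPath A (fun n => regTime τ n ω) (fun t => semiMarkov X τ t ω) f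
    (fun t => u t ω)

/-- A solution of the random Cauchy problem: an adapted process whose trajectories solve the
equation almost surely. -/
structure IsSolution [MeasurableSpace Ω] (P : Measure Ω) (X : ℕ → Ω → Fin N) (τ : ℕ → Ω → ℝ)
    (A : Fin N → H →ₗ.[ℂ] H) (f : H) (u : ℝ → Ω → H) : Prop where
  adapted : ∀ t : ℝ, 0 ≤ t → StronglyMeasurable[observed X τ t] (u t)
  solves : SolvesAlmostSurely P X τ A f u

/-- The ordered product
`e^{(T_n - T_{n-1}) A_{X_{n-1}}} ⋯ e^{(T_2 - T_1) A_{X_1}} e^{(T_1 - T_0) A_{X_0}}`. -/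
def orderedProduct (T : Fin N → ℝ → H →L[ℂ] H) (X : ℕ → Ω → Fin N) (τ : ℕ → Ω → ℝ) (ω : Ω) :
    ℕ → H →L[ℂ] H
  | 0 => 1
  | k + 1 => T (X k ω) (regTime τ (k + 1) ω - regTime τ k ω) * orderedProduct T X τ ω k

/-- The random propagator
`S(t) = e^{(t - T_n) A_{X_n}} ∏_{k < n} e^{(T_{k+1} - T_k) A_{X_k}}` for
`t ∈ [T_n, T_{n+1})`, that is, for `n = N(t)`. -/
def propagator (T : Fin N → ℝ → H →L[ℂ] H) (X : ℕ → Ω → Fin N) (τ : ℕ → Ω → ℝ) (t : ℝ)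
    (ω : Ω) : H →L[ℂ] H :=
  T (X (count τ t ω) ω) (t - regTime τ (count τ t ω) ω) *
    orderedProduct T X τ ω (count τ t ω)

end Solutions

end

end RandomEvolution

namespace RandomEvolution

/-! ### Orbits of an analytic contraction semigroup and dissipativity of its generator. -/

section Semigroups

variable {H : Type*} [NormedAddCommGroup H] [InnerProductSpace ℂ H]
  {A : H →ₗ.[ℂ] H} {T : ℝ → H →L[ℂ] H}

/-! Once the regeneration times almost surely increase strictly to infinity, well-posedness is a
pathwise matter.

Probability: no `G x` charges `(-∞, 0]`, so waiting times are a.s. positive. As there are finitely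
many states, one `ε > 0` gives `G x (Iic ε) ≤ 1/2` for all `x`. By the Markov property, `j`
consecutive waits are all at most `ε` with probability at most `2⁻ʲ`; hence a.s. infinitely many
waits exceed `ε` (`ae_tendsto_atTop`).

Existence: analyticity makes every orbit, from any vector of `H`, differentiable and domain-valued
for `t > 0` (`OperatorAssumption.hasDerivAt`). Adjacent pieces agree at switching times because the
new factor is `T j 0 = 1` (`propagator_eq_of_mem_Icc`).

Uniqueness: the difference of two solutions starts a piece at zero and its norm cannot grow, by
dissipativity; left continuity carries equality to the next switching time.

Adaptedness: on `{T_n ≤ t}` the data entering the first `n + 1` factors are observable by time `t`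
(`stronglyMeasurable_propagator`). -/

lemma isOpen_sector {δ : ℝ} (hδ : δ ≤ Real.pi / 2) : IsOpen (sector δ) := by
  rw [isOpen_iff_mem_nhds]
  rintro z ⟨hz, hz'⟩
  -- Half-angle at most `π / 2` keeps the sector off the cut of `arg`.
  have hs : z ∈ Complex.slitPlane := by
    rw [Complex.mem_slitPlane_iff_arg]
    refine ⟨fun h => ?_, hz⟩
    rw [h, abs_of_pos Real.pi_pos] at hz'
    linarith [Real.pi_pos]
  have hc : ContinuousAt (fun w : ℂ => |w.arg|) z := (Complex.continuousAt_arg hs).abs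
  filter_upwards [isOpen_ne.mem_nhds hz, hc.eventually_lt continuousAt_const hz'] with w h1 h2
  exact ⟨h1, h2⟩

lemma OperatorAssumption.contDiffOn [CompleteSpace H] (h : OperatorAssumption A T) (x : H) :
    ContDiffOn ℝ 1 (fun t => T t x) (Ioi 0) := by
  obtain ⟨δ, hδ, hδ', U, hU, -, hd, -⟩ := h.analytic
  have h1 : ContDiffOn ℝ 1 U (sector δ) := (hd.contDiffOn (isOpen_sector hδ')).restrict_scalars ℝ
  have hm : MapsTo (fun t : ℝ => (t : ℂ)) (Ioi 0) (sector δ) := by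
    intro t ht
    have ht' : (0 : ℝ) < t := ht
    refine ⟨Complex.ofReal_ne_zero.2 ht'.ne', ?_⟩
    rw [Complex.arg_ofReal_of_nonneg ht'.le]
    simpa using hδ
  have h2 : ContDiffOn ℝ 1 (fun t : ℝ => U (t : ℂ)) (Ioi 0) :=
    h1.comp Complex.ofRealCLM.contDiff.contDiffOn hm
  have h3 : ContDiffOn ℝ 1 (fun t : ℝ => U (t : ℂ) x) (Ioi 0) := by
    have := ((ContinuousLinearMap.apply ℂ H x).restrictScalars ℝ).contDiff (n := 1)
    exact this.comp_contDiffOn h2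
  exact h3.congr fun t ht => by rw [hU t ht]

/-- By the semigroup law, the right difference quotient of the orbit at `t` is the generator
quotient at `T t x`. Its limit exists by analyticity, which forces `T t x` into the domain. -/
lemma OperatorAssumption.hasDerivAt [CompleteSpace H] (h : OperatorAssumption A T) (x : H)
    {t : ℝ} (ht : 0 < t) :
    ∃ hx : T t x ∈ A.domain, HasDerivAt (fun s => T s x) (A ⟨T t x, hx⟩) t := by
  have hd : HasDerivAt (fun s => T s x) (deriv (fun s => T s x) t) t :=
    (((h.contDiffOn x).differentiableOn one_ne_zero).differentiableAt
      (Ioi_mem_nhds ht)).hasDerivAt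
  have hg : (T t x, deriv (fun s => T s x) t) ∈ A.graph := by
    rw [h.generator]
    refine ((hasDerivAt_iff_tendsto_slope_zero.1 hd).mono_left
      (nhdsWithin_mono _ fun s hs => ne_of_gt hs)).congr' ?_
    filter_upwards [self_mem_nhdsWithin] with s hs
    rw [add_comm t s, h.semigroup.add s t (le_of_lt hs) ht.le]
    rfl
  obtain ⟨y, hy, hy'⟩ := (LinearPMap.mem_graph_iff A).1 hg
  obtain ⟨y, hyd⟩ := y
  simp only at hy hy'
  subst hy
  exact ⟨hyd, hy' ▸ hd⟩

/-- Strong continuity in time combines with the 1-Lipschitz bound in the vector, uniform in time.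
The `max` extends the semigroup to all real times, for use in measurability. -/
lemma OperatorAssumption.continuous_prod (h : OperatorAssumption A T) :
    Continuous fun p : H × ℝ => T (max p.2 0) p.1 := by
  refine continuous_prod_of_continuous_lipschitzWith _ 1 (fun x => ?_) (fun r => ?_)
  · exact (h.semigroup.continuousOn x).comp_continuous (by fun_prop) 
      fun r => mem_Ici.2 (le_max_right r 0)
  · refine ((T (max r 0)).lipschitz).weaken ?_
    exact_mod_cast h.contraction _ (le_max_right r 0)

/-- Cauchy–Schwarz and contractivity give `Re ⟨x, T t x - x⟩ ≤ 0`; divide by `t` and let `t ↓ 0`. -/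
lemma OperatorAssumption.re_inner_nonpos (h : OperatorAssumption A T) (x : A.domain) :
    (inner ℂ (x : H) (A x)).re ≤ 0 := by
  have hg := (h.generator x (A x)).1 (A.mem_graph x)
  have ht : Tendsto (fun t : ℝ => (inner ℂ (x : H) (t⁻¹ • (T t x - x))).re) (𝓝[>] 0)
      (𝓝 (inner ℂ (x : H) (A x)).re) :=
    (Complex.continuous_re.tendsto _).comp (tendsto_const_nhds.inner hg)
  refine le_of_tendsto ht ?_
  filter_upwards [self_mem_nhdsWithin] with t ht
  have ht' : (0 : ℝ) < t := ht
  rw [← Complex.coe_smul, inner_smul_right, Complex.re_ofReal_mul, inner_sub_right,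
    Complex.sub_re]
  refine mul_nonpos_of_nonneg_of_nonpos (inv_nonneg.2 ht'.le) ?_
  have h1 : (inner ℂ (x : H) (x : H)).re = ‖(x : H)‖ * ‖(x : H)‖ :=
    inner_self_eq_norm_mul_norm (𝕜 := ℂ) (x : H)
  have h2 : (inner ℂ (x : H) (T t x)).re ≤ ‖(x : H)‖ * ‖T t x‖ :=
    re_inner_le_norm (𝕜 := ℂ) (x : H) (T t x)
  have h3 : ‖T t x‖ ≤ ‖(x : H)‖ := (T t).le_of_opNorm_le (h.contraction t ht'.le) x |>.trans
    (one_mul _).le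
  have := mul_le_mul_of_nonneg_left h3 (norm_nonneg (x : H))
  linarith

/-- A solution of `u' = A u` that starts from zero vanishes, by dissipativity of `A`. -/
lemma OperatorAssumption.eq_zero_of_tendsto_zero (h : OperatorAssumption A T) {a b : ℝ}
    {d : ℝ → H} (hd : ∀ t ∈ Ioo a b, ∃ hx : d t ∈ A.domain, HasDerivAt d (A ⟨d t, hx⟩) t)
    (h0 : Tendsto d (𝓝[>] a) (𝓝 0)) : ∀ t ∈ Ioo a b, d t = 0 := by
  have hder : ∀ t ∈ Ioo a b, ∃ c ≤ 0, HasDerivAt (fun s => (inner ℂ (d s) (d s)).re) c t := by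
    intro t ht
    obtain ⟨hx, hd'⟩ := hd t ht
    have h1 := Complex.reCLM.hasFDerivAt.comp_hasDerivAt t (hd'.inner ℂ hd')
    refine ⟨_, ?_, h1⟩
    have h2 := h.re_inner_nonpos ⟨d t, hx⟩
    have h3 : (inner ℂ (A ⟨d t, hx⟩) (d t)).re = (inner ℂ (d t) (A ⟨d t, hx⟩)).re :=
      inner_re_symm (𝕜 := ℂ) _ _
    simp only [Complex.reCLM_apply, Complex.add_re, h3]
    linarith
  have hanti : AntitoneOn (fun s => (inner ℂ (d s) (d s)).re) (Ioo a b) := by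
    refine antitoneOn_of_deriv_nonpos (convex_Ioo a b) ?_ ?_ ?_
    · intro t ht
      obtain ⟨c, -, hc⟩ := hder t ht
      exact hc.continuousAt.continuousWithinAt
    · intro t ht
      rw [interior_Ioo] at ht
      obtain ⟨c, -, hc⟩ := hder t ht
      exact hc.differentiableAt.differentiableWithinAt
    · intro t ht
      rw [interior_Ioo] at ht
      obtain ⟨c, hc0, hc⟩ := hder t ht
      rwa [hc.deriv]
  intro t ht
  have hlim : Tendsto (fun s => (inner ℂ (d s) (d s)).re) (𝓝[>] a) (𝓝 0) := by
    have := (Complex.continuous_re.tendsto _).comp (h0.inner (𝕜 := ℂ) h0)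
    rwa [inner_zero_left, Complex.zero_re] at this
  have hle : (inner ℂ (d t) (d t)).re ≤ 0 := by
    refine ge_of_tendsto hlim ?_
    filter_upwards [Ioo_mem_nhdsGT ht.1] with s hs
    exact hanti ⟨hs.1, hs.2.trans ht.2⟩ ht hs.2.le
  have hnorm : (inner ℂ (d t) (d t)).re = ‖d t‖ * ‖d t‖ :=
    inner_self_eq_norm_mul_norm (𝕜 := ℂ) (d t)
  rw [hnorm] at hle
  exact norm_eq_zero.1 (mul_self_eq_zero.1 (hle.antisymm (mul_self_nonneg _)))

end Semigroups

/-! ### Pathwise existence and uniqueness. -/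

section Paths

variable {Ω : Type*} {N : ℕ} {X : ℕ → Ω → Fin N} {τ : ℕ → Ω → ℝ} {ω : Ω}

@[simp] lemma regTime_zero (τ : ℕ → Ω → ℝ) (ω : Ω) : regTime τ 0 ω = 0 := by simp [regTime]

lemma regTime_succ (τ : ℕ → Ω → ℝ) (n : ℕ) (ω : Ω) :
    regTime τ (n + 1) ω = regTime τ n ω + τ (n + 1) ω := by
  simp [regTime, Finset.sum_range_succ]

lemma regTime_monotone (h : ∀ n, 0 ≤ τ n ω) : Monotone fun n => regTime τ n ω :=
  monotone_nat_of_le_succ fun n => by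
    rw [regTime_succ]
    linarith [h (n + 1)]

lemma count_eq (h : Monotone fun n => regTime τ n ω) {n : ℕ} {t : ℝ}
    (ht : t ∈ Ico (regTime τ n ω) (regTime τ (n + 1) ω)) : count τ t ω = n := by
  have hs : {k : ℕ | regTime τ k ω ≤ t} = Iic n := by
    ext k
    simp only [mem_ofPred_eq, mem_Iic]
    refine ⟨fun hk => ?_, fun hk => (h hk).trans ht.1⟩
    by_contra! hlt
    exact absurd ((h (Nat.succ_le_of_lt hlt)).trans hk) (not_le.2 ht.2)
  rw [count, hs, csSup_Iic]

lemma count_eq_zero {t : ℝ} (h : ∀ n, regTime τ n ω ≤ t) : count τ t ω = 0 := by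
  have hs : {k : ℕ | regTime τ k ω ≤ t} = univ := by
    ext k
    simp [h k]
  rw [count, hs]
  -- The supremum of an unbounded set of naturals is `0` by convention; adaptedness must cover these
  -- exceptional paths too.
  exact Nat.sSup_of_not_bddAbove (by simp)

lemma exists_mem_Ico_regTime {t : ℝ} (ht : 0 ≤ t) (h : ∃ n, t < regTime τ n ω) :
    ∃ n, t ∈ Ico (regTime τ n ω) (regTime τ (n + 1) ω) := by
  classical
  have hpos : Nat.find h ≠ 0 := by
    intro h0
    have := Nat.find_spec h
    rw [h0, regTime_zero] at this
    linarith
  obtain ⟨n, hn⟩ := Nat.exists_eq_succ_of_ne_zero hpos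
  refine ⟨n, not_lt.1 (Nat.find_min h (by omega)), ?_⟩
  have := Nat.find_spec h
  rwa [hn] at this

lemma exists_mem_Ioc_regTime {t : ℝ} (ht : 0 < t) (h : ∃ n, t ≤ regTime τ n ω) :
    ∃ n, t ∈ Ioc (regTime τ n ω) (regTime τ (n + 1) ω) := by
  classical
  have hpos : Nat.find h ≠ 0 := by
    intro h0
    have := Nat.find_spec h
    rw [h0, regTime_zero] at this
    linarith
  obtain ⟨n, hn⟩ := Nat.exists_eq_succ_of_ne_zero hpos
  refine ⟨n, not_le.1 (Nat.find_min h (by omega)), ?_⟩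
  have := Nat.find_spec h
  rwa [hn] at this

variable {H : Type*} [NormedAddCommGroup H] [InnerProductSpace ℂ H]
  {A : Fin N → H →ₗ.[ℂ] H} {T : Fin N → ℝ → H →L[ℂ] H}

/-- At the right endpoint the count is already `n + 1`, but the new factor is the identity, so the
formula of the `n`-th piece persists. This gives continuity across switches. -/
lemma propagator_eq_of_mem_Icc (hT : ∀ j, T j 0 = 1) (hs : StrictMono fun n => regTime τ n ω)
    {n : ℕ} {t : ℝ} (ht : t ∈ Icc (regTime τ n ω) (regTime τ (n + 1) ω)) :
    propagator T X τ t ω = T (X n ω) (t - regTime τ n ω) * orderedProduct T X τ ω n := by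
  rcases ht.2.lt_or_eq with hlt | rfl
  · rw [propagator, count_eq hs.monotone ⟨ht.1, hlt⟩]
  · rw [propagator, count_eq hs.monotone (n := n + 1) ⟨le_rfl, hs (Nat.lt_succ_self _)⟩, sub_self,
      hT, one_mul]
    rfl

lemma propagator_regTime (hT : ∀ j, T j 0 = 1) (hs : StrictMono fun n => regTime τ n ω) (n : ℕ) :
    propagator T X τ (regTime τ n ω) ω = orderedProduct T X τ ω n := by
  rw [propagator_eq_of_mem_Icc hT hs (n := n) ⟨le_rfl, (hs (Nat.lt_succ_self n)).le⟩, sub_self,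
    hT, one_mul]

lemma propagator_continuousOn_Icc (hA : ∀ j, OperatorAssumption (A j) (T j))
    (hs : StrictMono fun n => regTime τ n ω) (f : H) (n : ℕ) :
    ContinuousOn (fun t => propagator T X τ t ω f)
      (Icc (regTime τ n ω) (regTime τ (n + 1) ω)) := by
  have h := ((hA (X n ω)).semigroup.continuousOn (orderedProduct T X τ ω n f)).comp
    (f := fun t => t - regTime τ n ω) (s := Icc (regTime τ n ω) (regTime τ (n + 1) ω))
    (by fun_prop) fun t ht => sub_nonneg.2 ht.1
  refine h.congr fun t ht => ?_
  simp only [propagator_eq_of_mem_Icc (fun j => (hA j).semigroup.zero) hs ht]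
  rfl

lemma propagator_continuousOn (hA : ∀ j, OperatorAssumption (A j) (T j))
    (hs : StrictMono fun n => regTime τ n ω)
    (hinf : Tendsto (fun n => regTime τ n ω) atTop atTop) (f : H) :
    ContinuousOn (fun t => propagator T X τ t ω f) (Ici 0) := by
  intro t ht
  have hright : ContinuousWithinAt (fun t => propagator T X τ t ω f) (Ici t) t := by
    obtain ⟨n, hn⟩ := exists_mem_Ico_regTime ht (hinf.eventually_gt_atTop t).exists
    refine (propagator_continuousOn_Icc hA hs f n t ⟨hn.1, hn.2.le⟩).mono_of_mem_nhdsWithin ?_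
    exact mem_of_superset (Icc_mem_nhdsGE hn.2) (Icc_subset_Icc_left hn.1)
  rcases (mem_Ici.1 ht).eq_or_lt with rfl | hpos
  · exact hright
  -- At a switching time this selects the piece ending at `t`, as left continuity requires.
  obtain ⟨n, hn⟩ := exists_mem_Ioc_regTime hpos (hinf.eventually_ge_atTop t).exists
  have hleft : ContinuousWithinAt (fun t => propagator T X τ t ω f) (Iic t) t := by
    refine (propagator_continuousOn_Icc hA hs f n t ⟨hn.1.le, hn.2⟩).mono_of_mem_nhdsWithin ?_
    exact mem_of_superset (Icc_mem_nhdsLE hn.1) (Icc_subset_Icc_right hn.2)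
  exact (continuousAt_iff_continuous_left_right.2 ⟨hleft, hright⟩).continuousWithinAt

lemma propagator_contDiffOn [CompleteSpace H] (hA : ∀ j, OperatorAssumption (A j) (T j))
    (hs : StrictMono fun n => regTime τ n ω) (f : H) (n : ℕ) :
    ContDiffOn ℝ 1 (fun t => propagator T X τ t ω f)
      (Ioo (regTime τ n ω) (regTime τ (n + 1) ω)) := by
  have h := ((hA (X n ω)).contDiffOn (orderedProduct T X τ ω n f)).comp
    (f := fun t => t - regTime τ n ω) (s := Ioo (regTime τ n ω) (regTime τ (n + 1) ω))
    (by fun_prop) fun t ht => sub_pos.2 ht.1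
  refine h.congr fun t ht => ?_
  simp only [propagator_eq_of_mem_Icc (fun j => (hA j).semigroup.zero) hs (Ioo_subset_Icc_self ht)]
  rfl

lemma propagator_hasDerivAt [CompleteSpace H] (hA : ∀ j, OperatorAssumption (A j) (T j))
    (hs : StrictMono fun n => regTime τ n ω) (f : H) {n : ℕ} {t : ℝ}
    (ht : t ∈ Ioo (regTime τ n ω) (regTime τ (n + 1) ω)) :
    ∃ h : propagator T X τ t ω f ∈ (A (X n ω)).domain,
      HasDerivAt (fun t => propagator T X τ t ω f) (A (X n ω) ⟨_, h⟩) t := by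
  have heq : ∀ r ∈ Ioo (regTime τ n ω) (regTime τ (n + 1) ω), propagator T X τ r ω f =
      T (X n ω) (r - regTime τ n ω) (orderedProduct T X τ ω n f) := fun r hr => by
    rw [propagator_eq_of_mem_Icc (fun j => (hA j).semigroup.zero) hs (Ioo_subset_Icc_self hr)]
    rfl
  obtain ⟨hx, hd⟩ := (hA (X n ω)).hasDerivAt (orderedProduct T X τ ω n f) (sub_pos.2 ht.1)
  refine ⟨by rwa [heq t ht], ?_⟩
  have h2 := (hd.comp_sub_const t (regTime τ n ω)).congr_of_eventuallyEq
    (f₁ := fun t => propagator T X τ t ω f)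
    (by filter_upwards [isOpen_Ioo.mem_nhds ht] with r hr using heq r hr)
  convert h2 using 3
  exact heq t ht

lemma semiMarkov_eq (hs : StrictMono fun n => regTime τ n ω) {n : ℕ} {t : ℝ}
    (ht : t ∈ Ioo (regTime τ n ω) (regTime τ (n + 1) ω)) : semiMarkov X τ t ω = X n ω := by
  rw [semiMarkov, count_eq hs.monotone (Ioo_subset_Ico_self ht)]

lemma regTime_nonneg (hs : StrictMono fun n => regTime τ n ω) (n : ℕ) : 0 ≤ regTime τ n ω := by
  simpa using hs.monotone (Nat.zero_le n)

lemma propagator_isSolutionPath [CompleteSpace H] (hA : ∀ j, OperatorAssumption (A j) (T j))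
    (hs : StrictMono fun n => regTime τ n ω)
    (hinf : Tendsto (fun n => regTime τ n ω) atTop atTop) (f : H) :
    IsSolutionPath A (fun n => regTime τ n ω) (fun t => semiMarkov X τ t ω) f
      (fun t => propagator T X τ t ω f) := by
  have hc := propagator_continuousOn (X := X) hA hs hinf f
  refine ⟨?_, ⟨fun t ht => ?_, fun t ht => ⟨propagator T X τ t ω f, ?_⟩⟩, fun n => ?_,
    propagator_contDiffOn hA hs f, fun n t ht => ?_⟩
  · have := propagator_regTime (T := T) (X := X) (fun j => (hA j).semigroup.zero) hs 0
    rw [regTime_zero] at this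
    simp only [this, orderedProduct]
    rfl
  · exact (hc.continuousAt (Ici_mem_nhds ht)).tendsto.mono_left nhdsWithin_le_nhds
  · exact ((hc t ht).mono (Ioi_subset_Ici ht)).tendsto
  · exact ((hc _ (regTime_nonneg hs n)).mono (Ioi_subset_Ici (regTime_nonneg hs n))).tendsto
  · have h := propagator_hasDerivAt (X := X) hA hs f ht
    rwa [← semiMarkov_eq (X := X) hs ht] at h

/-- Solutions of `u' = A(z(t)) u` are determined by their initial value. -/
lemma IsSolutionPath.unique (hA : ∀ j, OperatorAssumption (A j) (T j)) {s : ℕ → ℝ}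
    {z : ℝ → Fin N} {y : ℕ → Fin N} {f : H} {u v : ℝ → H} (h0 : s 0 = 0)
    (hs : StrictMono s) (hz : ∀ n, ∀ t ∈ Ioo (s n) (s (n + 1)), z t = y n)
    (hu : IsSolutionPath A s z f u) (hv : IsSolutionPath A s z f v) (n : ℕ) :
    ∀ t ∈ Icc (s n) (s (n + 1)), u t = v t := by
  have hpiece : ∀ n, u (s n) = v (s n) → ∀ t ∈ Icc (s n) (s (n + 1)), u t = v t := by
    intro n hn
    have hIoo : ∀ t ∈ Ioo (s n) (s (n + 1)), u t - v t = 0 := by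
      refine (hA (y n)).eq_zero_of_tendsto_zero (d := fun t => u t - v t) (fun t ht => ?_) ?_
      · obtain ⟨h1, h1'⟩ := hu.equation n t ht
        obtain ⟨h2, h2'⟩ := hv.equation n t ht
        rw [← hz n t ht]
        refine ⟨Submodule.sub_mem _ h1 h2, ?_⟩
        have := (A (z t)).map_sub ⟨u t, h1⟩ ⟨v t, h2⟩
        exact this ▸ h1'.sub h2'
      · have := (hu.start n).sub (hv.start n)
        rwa [hn, sub_self] at this
    have hlt : s n < s (n + 1) := hs (Nat.lt_succ_self n)
    have hpos : 0 < s (n + 1) := by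
      rw [← h0]
      exact hs (Nat.succ_pos n)
    rintro t ⟨ht1, ht2⟩
    rcases ht1.eq_or_lt with rfl | ht1
    · exact hn
    rcases ht2.eq_or_lt with rfl | ht2
    -- Left continuity excludes a jump at the end of the piece.
    · refine tendsto_nhds_unique (hu.caglad.1 _ hpos) ((hv.caglad.1 _ hpos).congr' ?_)
      filter_upwards [Ioo_mem_nhdsLT hlt] with r hr
      exact (sub_eq_zero.1 (hIoo r hr)).symm
    · exact sub_eq_zero.1 (hIoo t ⟨ht1, ht2⟩)
  have hstart : ∀ n, u (s n) = v (s n) := by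
    intro n
    induction n with
    | zero => rw [h0, hu.init, hv.init]
    | succ n ih => exact hpiece n ih _ ⟨(hs (Nat.lt_succ_self n)).le, le_rfl⟩
  exact hpiece n (hstart n)

end Paths

/-! ### Adaptedness of the propagator. -/

section Adapted

variable {Ω : Type*} {N : ℕ} {X : ℕ → Ω → Fin N} {τ : ℕ → Ω → ℝ} {t : ℝ}

lemma measurable_time_history (X : ℕ → Ω → Fin N) (τ : ℕ → Ω → ℝ) {k n : ℕ} (hk : k ≤ n) :
    Measurable[history X τ n] (τ k) := by
  have h1 : Measurable[MeasurableSpace.comap (fun ω => (X k ω, τ k ω)) inferInstance] (τ k) :=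
    measurable_snd.comp (comap_measurable fun ω => (X k ω, τ k ω))
  refine h1.mono ?_ le_rfl
  exact le_iSup₂_of_le (f := fun k (_ : k ∈ Finset.range (n + 1)) =>
    MeasurableSpace.comap (fun ω => (X k ω, τ k ω)) inferInstance) k
    (Finset.mem_range.2 (Nat.lt_succ_of_le hk)) le_rfl

lemma measurableSet_regTime_le {s : ℝ} (hs : s ≤ t) (n : ℕ) :
    MeasurableSet[observed X τ t] {ω | regTime τ n ω ≤ s} :=
  MeasurableSpace.measurableSet_generateFrom ⟨s, hs, n, univ, by simp⟩

lemma measurableSet_regTime_le_inter {k n : ℕ} (hk : k ≤ n) (j : Fin N) :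
    MeasurableSet[observed X τ t] ({ω | regTime τ n ω ≤ t} ∩ {ω | X k ω = j}) :=
  MeasurableSpace.measurableSet_generateFrom
    ⟨t, le_rfl, n, {x | x ⟨k, Nat.lt_succ_of_le hk⟩ = j}, rfl⟩

/-- Events `{T_n ≤ s}` are available only for `s ≤ t`, so the time is truncated at `t`. -/
lemma measurable_min_regTime (n : ℕ) :
    Measurable[observed X τ t] fun ω => min (regTime τ n ω) t := by
  let := observed X τ t
  refine measurable_of_Iic fun a => ?_
  by_cases ha : t ≤ a
  · convert @MeasurableSet.univ _ (observed X τ t)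
    ext ω
    simp [ha]
  · convert measurableSet_regTime_le (X := X) (τ := τ) (not_le.1 ha).le n
    ext ω
    simp [ha]

lemma measurable_count (hτ : ∀ n ω, 0 ≤ τ n ω) (ht : 0 ≤ t) :
    Measurable[observed X τ t] (count τ t) := by
  refine @measurable_to_countable' _ _ _ _ (observed X τ t) _ fun n => ?_
  have hle := fun n => measurableSet_regTime_le (X := X) (τ := τ) (le_refl t) n
  have hIco : MeasurableSet[observed X τ t]
      {ω | t ∈ Ico (regTime τ n ω) (regTime τ (n + 1) ω)} := by
    convert (hle n).diff (hle (n + 1)) using 1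
    ext ω
    simp
  -- Paths with all regeneration times at most `t` have default count `0`.
  have hall : MeasurableSet[observed X τ t] {ω | n = 0 ∧ ∀ k, regTime τ k ω ≤ t} := by
    by_cases hn : n = 0
    · convert MeasurableSet.iInter hle using 1
      ext ω
      simp [hn]
    · simp [hn]
  convert hIco.union hall using 1
  ext ω
  simp only [mem_preimage, mem_singleton_iff, mem_union, mem_ofPred_eq]
  constructor
  · intro h
    by_cases hk : ∀ k, regTime τ k ω ≤ t
    · exact Or.inr ⟨by rw [← h, count_eq_zero hk], hk⟩
    · push Not at hk
      obtain ⟨m, hm⟩ := exists_mem_Ico_regTime ht hk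
      rw [count_eq (regTime_monotone fun n => hτ n ω) hm] at h
      exact Or.inl (h ▸ hm)
  · rintro (h | ⟨rfl, h⟩)
    · exact count_eq (regTime_monotone fun n => hτ n ω) h
    · exact count_eq_zero h

lemma regTime_count_le (hτ : ∀ n ω, 0 ≤ τ n ω) (ht : 0 ≤ t) (ω : Ω) :
    regTime τ (count τ t ω) ω ≤ t := by
  by_cases hk : ∀ k, regTime τ k ω ≤ t
  · exact hk _
  · push Not at hk
    obtain ⟨m, hm⟩ := exists_mem_Ico_regTime ht hk
    rw [count_eq (regTime_monotone fun n => hτ n ω) hm]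
    exact hm.1

variable {H : Type*} [NormedAddCommGroup H] [InnerProductSpace ℂ H]
  {A : Fin N → H →ₗ.[ℂ] H} {T : Fin N → ℝ → H →L[ℂ] H}

/-- Splitting over the finitely many values of `Y` leaves jointly continuous maps of `(g, r)`. The
state need be measurable only on `D`. -/
lemma stronglyMeasurable_indicator_semigroup {m : MeasurableSpace Ω}
    (hA : ∀ j, OperatorAssumption (A j) (T j)) {D : Set Ω} {Y : Ω → Fin N}
    (hD : ∀ j, MeasurableSet (D ∩ {ω | Y ω = j})) {r : Ω → ℝ} (hr : Measurable r) {g : Ω → H}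
    (hg : StronglyMeasurable g) :
    StronglyMeasurable (D.indicator fun ω => T (Y ω) (max (r ω) 0) (g ω)) := by
  have h : ∀ j, StronglyMeasurable
      ((D ∩ {ω | Y ω = j}).indicator fun ω => T j (max (r ω) 0) (g ω)) := fun j =>
    ((hA j).continuous_prod.comp_stronglyMeasurable
      (hg.prodMk hr.stronglyMeasurable)).indicator (hD j)
  have hsum := Finset.stronglyMeasurable_fun_sum Finset.univ fun j _ => h j
  convert hsum using 1
  ext ω
  by_cases hω : ω ∈ D
  · rw [Finset.sum_eq_single (Y ω)]
    · simp [hω]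
    · intro j _ hj
      simp [hj.symm]
    · simp
  · simp [hω]

/-- The event `{T_n ≤ t}` stays fixed while `k` grows; on it the truncations at `t` are inactive. -/
lemma stronglyMeasurable_indicator_orderedProduct (hτ : ∀ n ω, 0 ≤ τ n ω)
    (hA : ∀ j, OperatorAssumption (A j) (T j)) (f : H) {k n : ℕ} (hk : k ≤ n) :
    StronglyMeasurable[observed X τ t]
      ({ω | regTime τ n ω ≤ t}.indicator fun ω => orderedProduct T X τ ω k f) := by
  induction k with
  | zero =>
    exact (@stronglyMeasurable_const _ _ (observed X τ t) _ f).indicator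
      (measurableSet_regTime_le le_rfl n)
  | succ k ih =>
    have h := stronglyMeasurable_indicator_semigroup hA
      (fun j => measurableSet_regTime_le_inter (X := X) (τ := τ) (t := t)
        ((Nat.le_succ k).trans hk) j)
      ((measurable_min_regTime (X := X) (k + 1)).sub (measurable_min_regTime k))
      (ih ((Nat.le_succ k).trans hk))
    convert h using 1
    ext ω
    by_cases hω : regTime τ n ω ≤ t
    · have hmono := regTime_monotone fun n => hτ n ω
      have h1 : regTime τ (k + 1) ω ≤ t := (hmono hk).trans hω
      have h2 : regTime τ k ω ≤ regTime τ (k + 1) ω := hmono (Nat.le_succ k)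
      have h3 : regTime τ k ω ≤ t := h2.trans h1
      simp [hω, h1, h2, h3, orderedProduct]
    · simp [hω]

lemma stronglyMeasurable_propagator [TopologicalSpace.SeparableSpace H]
    (hτ : ∀ n ω, 0 ≤ τ n ω) (hA : ∀ j, OperatorAssumption (A j) (T j)) (f : H) (ht : 0 ≤ t) :
    StronglyMeasurable[observed X τ t] fun ω => propagator T X τ t ω f := by
  borelize H
  have : SecondCountableTopology H := UniformSpace.secondCountable_of_separable H
  let F : ℕ → Ω → H := fun n => {ω | regTime τ n ω ≤ t}.indicator fun ω =>
    T (X n ω) (max (t - min (regTime τ n ω) t) 0)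
      ({ω | regTime τ n ω ≤ t}.indicator (fun ω => orderedProduct T X τ ω n f) ω)
  have hF : ∀ n, StronglyMeasurable[observed X τ t] (F n) := fun n =>
    stronglyMeasurable_indicator_semigroup hA
      (measurableSet_regTime_le_inter le_rfl) ((measurable_min_regTime n).const_sub t)
      (stronglyMeasurable_indicator_orderedProduct hτ hA f le_rfl)
  have heq : (fun ω => propagator T X τ t ω f) = fun ω => F (count τ t ω) ω := by
    ext ω
    have h := regTime_count_le hτ ht ω
    simp [F, h, propagator]
  rw [heq]
  let := observed X τ t
  refine Measurable.stronglyMeasurable ?_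
  -- The random index `N(t)` takes countably many values, so measurability for each fixed `n`
  -- suffices.
  have hp : Measurable fun p : ℕ × Ω => F p.1 p.2 :=
    measurable_from_prod_countable_right fun n => (hF n).measurable
  exact hp.comp ((measurable_count hτ ht).prodMk measurable_id)

end Adapted

/-! ### Positivity of waiting times and non-explosion. -/

section Probability

variable {Ω : Type*} [MeasurableSpace Ω] {P : Measure Ω} {N : ℕ} {X : ℕ → Ω → Fin N}
  {τ : ℕ → Ω → ℝ} {π : Matrix (Fin N) (Fin N) ℝ} {G : Fin N → Measure ℝ}

/-- A Dirac mass sits at its mean, which is positive; a density on `(0, ∞)` gives no mass elsewhere.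
-/
lemma SwitchingAssumption.law_Iic_zero (hZ : SwitchingAssumption P X τ π G) (x : Fin N) :
    G x (Iic 0) = 0 := by
  rcases hZ.waiting with ⟨c, hc⟩ | h
  · have hpos := hZ.mean_pos x
    rw [hc x, integral_dirac] at hpos
    rw [hc x, Measure.dirac_apply' _ measurableSet_Iic,
      indicator_of_notMem (fun h => (mem_Iic.1 h).not_gt hpos)]
  · obtain ⟨g, -, -, hg⟩ := h x
    rw [hg]
    refine withDensity_absolutelyContinuous _ _ ?_
    rw [Measure.restrict_apply measurableSet_Iic, inter_comm, Ioi_inter_Iic, Ioc_self,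
      measure_empty]

/-- Continuity from above at `0` gives an `ε` for each state; finiteness of the state space makes it
uniform. -/
lemma SwitchingAssumption.exists_law_Iic_le (hZ : SwitchingAssumption P X τ π G) :
    ∃ ε : ℝ, 0 < ε ∧ ∀ x, G x (Iic ε) ≤ 2⁻¹ := by
  have h : ∀ x, ∀ᶠ ε : ℝ in 𝓝[>] 0, G x (Iic ε) ≤ 2⁻¹ := by
    intro x
    have := hZ.renewal.law x
    have ht := tendsto_measure_biInter_gt (μ := G x) (s := fun r : ℝ => Iic r) (a := 0)
      (fun r _ => measurableSet_Iic.nullMeasurableSet) (fun i j _ hij => Iic_subset_Iic.2 hij)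
      ⟨1, one_pos, measure_ne_top _ _⟩
    have hI : ⋂ r > (0 : ℝ), Iic r = Iic 0 := by
      ext y
      simp only [mem_iInter, mem_Iic]
      exact ⟨fun h => le_of_forall_gt_imp_ge_of_dense h, fun h r hr => h.trans (le_of_lt hr)⟩
    rw [hI, hZ.law_Iic_zero x] at ht
    exact ht.eventually_le_const (by simp)
  obtain ⟨ε, hε, hpos⟩ := ((eventually_all.2 h).and self_mem_nhdsWithin).exists
  exact ⟨ε, hpos, hε⟩

/-- Sum the Markov property over the current and next states; the rows of `π` sum to one. -/
lemma IsMarkovRenewal.measure_inter_le (h : IsMarkovRenewal P X τ π G) {n : ℕ} {S : Set Ω}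
    (hS : MeasurableSet[history X τ n] S) {B : Set ℝ} (hB : MeasurableSet B) {p : ENNReal}
    (hp : ∀ x, G x B ≤ p) : P (S ∩ {ω | τ (n + 1) ω ∈ B}) ≤ p * P S := by
  have hsum : ∑ x, P (S ∩ {ω | X n ω = x}) = P S := by
    have h1 := sum_measure_preimage_singleton (μ := P.restrict S) (f := X n) Finset.univ
      fun y _ => h.measurable_state n (measurableSet_singleton y)
    simp only [Finset.coe_univ, preimage_univ, Measure.restrict_apply_univ] at h1
    rw [← h1]
    refine Finset.sum_congr rfl fun x _ => ?_
    rw [Measure.restrict_apply (h.measurable_state n (measurableSet_singleton x)), inter_comm]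
    rfl
  have hrow : ∀ x, ∑ y, ENNReal.ofReal (π x y) = 1 := fun x => by
    rw [← ENNReal.ofReal_sum_of_nonneg fun y _ =>
      Matrix.nonneg_of_mem_rowStochastic h.stochastic,
      Matrix.sum_row_of_mem_rowStochastic h.stochastic, ENNReal.ofReal_one]
  have hsub : S ∩ {ω | τ (n + 1) ω ∈ B} ⊆
      ⋃ x, ⋃ y, S ∩ {ω | X n ω = x ∧ X (n + 1) ω = y ∧ τ (n + 1) ω ∈ B} := by
    rintro ω ⟨h1, h2⟩
    simp only [mem_iUnion]
    exact ⟨_, _, h1, rfl, rfl, h2⟩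
  calc P (S ∩ {ω | τ (n + 1) ω ∈ B})
      ≤ ∑ x, ∑ y, P (S ∩ {ω | X n ω = x ∧ X (n + 1) ω = y ∧ τ (n + 1) ω ∈ B}) :=
        (measure_mono hsub).trans <| (measure_iUnion_fintype_le _ _).trans <|
          Finset.sum_le_sum fun x _ => measure_iUnion_fintype_le _ _
    _ = ∑ x, P (S ∩ {ω | X n ω = x}) * G x B := by
        refine Finset.sum_congr rfl fun x _ => ?_
        simp only [h.markov n S hS x _ B hB]
        rw [← Finset.mul_sum, ← Finset.sum_mul, hrow, one_mul]
    _ ≤ ∑ x, P (S ∩ {ω | X n ω = x}) * p :=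
        Finset.sum_le_sum fun x _ => mul_le_mul_right (hp x) _
    _ = p * P S := by rw [← Finset.sum_mul, hsum, mul_comm]

lemma SwitchingAssumption.ae_strictMono (hZ : SwitchingAssumption P X τ π G) :
    ∀ᵐ ω ∂P, StrictMono fun n => regTime τ n ω := by
  have h : ∀ n, ∀ᵐ ω ∂P, 0 < τ (n + 1) ω := by
    intro n
    have := hZ.renewal.measure_inter_le (n := n) (S := univ) (@MeasurableSet.univ _ _)
      measurableSet_Iic fun x => (hZ.law_Iic_zero x).le
    rw [zero_mul, nonpos_iff_eq_zero, univ_inter] at this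
    rw [ae_iff]
    simpa using this
  filter_upwards [ae_all_iff.2 h] with ω hω
  refine strictMono_nat_of_lt_succ fun n => ?_
  rw [regTime_succ]
  linarith [hω n]

lemma SwitchingAssumption.ae_exists_lt [IsProbabilityMeasure P]
    (hZ : SwitchingAssumption P X τ π G) {ε : ℝ} (hε : ∀ x, G x (Iic ε) ≤ 2⁻¹) (m : ℕ) :
    ∀ᵐ ω ∂P, ∃ k, ε < τ (m + k + 1) ω := by
  have hbound : ∀ j : ℕ, P {ω | ∀ k < j, τ (m + k + 1) ω ≤ ε} ≤ 2⁻¹ ^ j := by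
    intro j
    induction j with
    | zero => simp
    | succ j ih =>
      have hS : MeasurableSet[history X τ (m + j)] {ω | ∀ k < j, τ (m + k + 1) ω ≤ ε} := by
        simp only [ofPred_forall]
        refine MeasurableSet.iInter fun k => MeasurableSet.iInter fun hk => ?_
        exact measurable_time_history X τ (by omega) measurableSet_Iic
      have hset : {ω | ∀ k < j + 1, τ (m + k + 1) ω ≤ ε} =
          {ω | ∀ k < j, τ (m + k + 1) ω ≤ ε} ∩ {ω | τ (m + j + 1) ω ∈ Iic ε} := by
        ext ω
        exact Nat.forall_lt_succ_right
      rw [hset, pow_succ']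
      exact (hZ.renewal.measure_inter_le hS measurableSet_Iic hε).trans
        (mul_le_mul_right ih _)
  have hzero : P {ω | ∀ k, τ (m + k + 1) ω ≤ ε} = 0 := by
    refine nonpos_iff_eq_zero.1 (ge_of_tendsto' (ENNReal.tendsto_pow_atTop_nhds_zero_of_lt_one
      (r := 2⁻¹) (by simp)) fun j => ?_)
    exact (measure_mono (ofPred_subset_ofPred.2 fun ω hω k _ => hω k)).trans (hbound j)
  rw [ae_iff]
  simpa using hzero

lemma SwitchingAssumption.ae_tendsto_atTop [IsProbabilityMeasure P]
    (hZ : SwitchingAssumption P X τ π G) :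
    ∀ᵐ ω ∂P, Tendsto (fun n => regTime τ n ω) atTop atTop := by
  obtain ⟨ε, hpos, hε⟩ := hZ.exists_law_Iic_le
  filter_upwards [ae_all_iff.2 (hZ.ae_exists_lt hε)] with ω hω
  have hmono := regTime_monotone fun n => hZ.renewal.time_nonneg n ω
  refine tendsto_atTop_atTop_of_monotone hmono fun b => ?_
  have hlarge : ∀ j : ℕ, ∃ n, j * ε ≤ regTime τ n ω := by
    intro j
    induction j with
    | zero => exact ⟨0, by simp⟩
    | succ j ih =>
      obtain ⟨n, hn⟩ := ih
      obtain ⟨k, hk⟩ := hω n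
      refine ⟨n + k + 1, ?_⟩
      have : regTime τ n ω ≤ regTime τ (n + k) ω := hmono (Nat.le_add_right n k)
      rw [regTime_succ]
      push_cast
      linarith
  obtain ⟨j, hj⟩ := exists_nat_ge (b / ε)
  obtain ⟨n, hn⟩ := hlarge j
  exact ⟨n, ((div_le_iff₀ hpos).1 hj).trans hn⟩

end Probability

end RandomEvolution

open RandomEvolution in
/-- Well-posedness of the random Cauchy problem `u' = A(Z(t)) u`, `u(0) = f`. Uniqueness is up to
indistinguishability, and holds even among processes that are not adapted. -/
theorem theorem2p5 {Ω : Type*} [MeasurableSpace Ω] (P : Measure Ω) [IsProbabilityMeasure P]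
    {N : ℕ} {H : Type*} [NormedAddCommGroup H] [InnerProductSpace ℂ H] [CompleteSpace H]
    [TopologicalSpace.SeparableSpace H]
    (X : ℕ → Ω → Fin N) (τ : ℕ → Ω → ℝ) (π : Matrix (Fin N) (Fin N) ℝ) (G : Fin N → Measure ℝ)
    (hZ : SwitchingAssumption P X τ π G)
    (A : Fin N → H →ₗ.[ℂ] H) (T : Fin N → ℝ → H →L[ℂ] H)
    (hA : ∀ j, OperatorAssumption (A j) (T j)) (f : H) :
    -- the regeneration times almost surely partition `[0, ∞)`
    (∀ᵐ ω ∂P, StrictMono (fun n => regTime τ n ω) ∧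
      Tendsto (fun n => regTime τ n ω) atTop atTop) ∧
    -- `S(t) f` is a solution
    IsSolution P X τ A f (fun t ω => propagator T X τ t ω f) ∧
    -- it is the only one
    (∀ v : ℝ → Ω → H, SolvesAlmostSurely P X τ A f v →
      ∀ᵐ ω ∂P, ∀ t : ℝ, 0 ≤ t → v t ω = propagator T X τ t ω f) ∧
    -- its sample paths are continuous
    (∀ᵐ ω ∂P, ContinuousOn (fun t => propagator T X τ t ω f) (Ici 0)) := by
  have hs := hZ.ae_strictMono
  have hinf := hZ.ae_tendsto_atTop
  refine ⟨hs.and hinf, ⟨fun t ht => ?_, ?_⟩, fun v hv => ?_, ?_⟩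
  · exact stronglyMeasurable_propagator hZ.renewal.time_nonneg hA f ht
  · filter_upwards [hs, hinf] with ω h1 h2
    exact propagator_isSolutionPath hA h1 h2 f
  · filter_upwards [hs, hinf, hv] with ω h1 h2 h3 t ht
    obtain ⟨n, hn⟩ := exists_mem_Ico_regTime ht (h2.eventually_gt_atTop t).exists
    exact h3.unique hA (y := fun n => X n ω) (regTime_zero τ ω) h1
      (fun n t ht => semiMarkov_eq h1 ht) (propagator_isSolutionPath hA h1 h2 f) n t
      ⟨hn.1, hn.2.le⟩
  · filter_upwards [hs, hinf] with ω h1 h2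
    exact propagator_continuousOn hA h1 h2 f
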